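/- Let $p$ be a prime number and let $\overline{R}$ be a principal Artinian local ring (commutative, with $1$) with maximal ideal $\overline{\mathfrak m}$, whose residue field is perfect of characteristic $p$. Let $\overline{R}$ have length $n$, in the sense that $\overline{\mathfrak m}^{\,n}=0$ and $\overline{\mathfrak m}^{\,n-1}\neq 0$, and suppose that no subring of $\overline{R}$ is a finite field. For a positive integer $a$, let $\nu(a)$ denote the least integer $k\ge 0$ with $a\overline{R}=\overline{\mathfrak m}^{\,k}$ (such a $k$ exists; it is the only one if $a\ne 0$ in $\overline{R}$, and it equals $n$ if $a=0$ in $\overline{R}$). Suppose that $$n>\nu(p)+\nu(p)\,\nu\big(\nu(p)\big).$$ Then there exists a complete discrete valuation ring $R$ of characteristic $0$, with maximal ideal $\mathfrak m$, whose $n$-th residue ring $R/\mathfrak m^n$ is isomorphic to $\overline{R}$. Such a ring is unique up to isomorphism: if $S$ is a complete discrete valuation ring of characteristic $0$ whose $n$-th residue ring is isomorphic to $\overline{R}$, then $S\cong R$ as rings. -/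

import Mathlib

universe u v

namespace ResidueRings

open IsLocalRing

/-- The `n`-th residue ring `R / 𝔪 ^ n` of a local ring `R` with maximal ideal `𝔪`. -/
abbrev ResidueRing (R : Type u) [CommRing R] [IsLocalRing R] (n : ℕ) : Type u :=
  R ⧸ (maximalIdeal R ^ n)

/-- A local ring has length `n` if `𝔪 ^ n = 0` and `𝔪 ^ (n - 1) ≠ 0`.
(A local ring is nontrivial, so `𝔪 ^ 0 ≠ 0` and the case `n = 0` never occurs.) -/
def HasLength (A : Type u) [CommRing A] [IsLocalRing A] (n : ℕ) : Prop :=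
  maximalIdeal A ^ n = ⊥ ∧ maximalIdeal A ^ (n - 1) ≠ ⊥

/-- No subring of `A` is a finite field. -/
def HasNoFiniteSubfield (A : Type u) [CommRing A] : Prop :=
  ¬ ∃ S : Subring A, IsField S ∧ Finite S

/-- For a natural number `a`, the exponent `k` with `a A = 𝔪 ^ k`. In a principal Artinian local
ring of length `n` every ideal is a power of `𝔪`, and `k` is unique if `a ≠ 0` in `A`; if `a = 0`
in `A`, the exponents are all `k ≥ n`, and the least of them, `n`, is taken. -/
noncomputable def nu (A : Type u) [CommRing A] [IsLocalRing A] (a : ℕ) : ℕ :=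
  sInf {k : ℕ | Ideal.span {(a : A)} = maximalIdeal A ^ k}

end ResidueRings

/-! Write `k` for the residue field of `A`, `e = ν(p)`, `r = ν(e)`, and let `π` generate the maximal
ideal of `A`.

Existence. As `k` is perfect, the identity of `k` lifts to `W(k) → A` (`WittVector.exists_lift`).
Expanding elements of `A` in powers of `π` with coefficients from `W(k)` gives `π ^ e = p * q(π)`
with `deg q < e` and `q(0)` a unit (`exists_pow_eq_mul_eval₂`). Then `f = X ^ e - p q` is
Eisenstein, so `R = W(k)[X]/(f)` is a complete discrete valuation ring. It maps onto `A` by `X ↦ π`,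
and the length of `A` forces the kernel to be `𝔪 ^ n`.

Uniqueness. If `S/𝔪 ^ n ≅ A`, then `W(k)` also maps to `S`, compatibly with `W(k) → A` by
`WittVector.ringHom_ext_of_nilpotent`. A lift `y` of `π` therefore satisfies `f(y) ∈ 𝔪 ^ n`. The
rescaled polynomial `f(y t) / y ^ e` has valuation at least `n - e` at `t = 1`, and its derivative
there has valuation at most `r`. Since `n - e > 2 r`, Hensel's lemma corrects `y` to a true root of
`f` that is still a uniformizer (`IsDiscreteValuationRing.exists_unit_eval₂_mul_eq_zero`). Sending
`X` to that root gives the isomorphism `R ≅ S`. -/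

/-! ### Homomorphisms out of the Witt vectors of a perfect field. -/

section WittLift

open IsLocalRing Polynomial

variable {p : ℕ} [Fact p.Prime] {k : Type*} [Field k] [CharP k p] [PerfectRing k p]
  {B : Type*} [CommRing B]

open WittVector in
/-- If every Witt component of `x` lies in an ideal `I` containing `p`, then the `n`-th ghost
component of `x` lies in `I ^ (n + 1)`. -/
theorem WittVector.ghostComponent_mem_pow {I : Ideal B} (hp : (p : B) ∈ I) (x : WittVector p B)
    (hx : ∀ i, x.coeff i ∈ I) (n : ℕ) : ghostComponent n x ∈ I ^ (n + 1) := by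
  rw [ghostComponent_apply, wittPolynomial_eq_sum_C_mul_X_pow, map_sum]
  refine sum_mem fun i hi ↦ ?_
  have hi : i ≤ n := by simpa [Nat.lt_succ_iff] using hi
  have h1 : n - i + 1 ≤ p ^ (n - i) := Nat.lt_pow_self (Fact.out : p.Prime).one_lt
  have h2 : (p : B) ^ i * x.coeff i ^ p ^ (n - i) ∈ I ^ (i + p ^ (n - i)) := by
    rw [pow_add]
    exact Ideal.mul_mem_mul (Ideal.pow_mem_pow hp _) (Ideal.pow_mem_pow (hx i) _)
  simpa using Ideal.pow_le_pow_right (by omega) h2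

/-- The ghost component `W(B) → B` descends to `W(B / I) → B / I ^ (n + 1)`. -/
noncomputable def WittVector.ghostComponentMod {I : Ideal B} (hp : (p : B) ∈ I) (n : ℕ) :
    WittVector p (B ⧸ I) →+* B ⧸ I ^ (n + 1) :=
  RingHom.liftOfSurjective (WittVector.map (Ideal.Quotient.mk I))
    (WittVector.map_surjective _ Ideal.Quotient.mk_surjective)
    ⟨(Ideal.Quotient.mk (I ^ (n + 1))).comp (WittVector.ghostComponent n), by
      intro x hx
      rw [RingHom.mem_ker] at hx
      rw [RingHom.mem_ker, RingHom.comp_apply, Ideal.Quotient.eq_zero_iff_mem]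
      refine WittVector.ghostComponent_mem_pow hp x (fun i ↦ ?_) n
      rw [← Ideal.Quotient.eq_zero_iff_mem, ← WittVector.map_coeff, hx, WittVector.zero_coeff]⟩

theorem WittVector.ghostComponentMod_map_mk {I : Ideal B} (hp : (p : B) ∈ I) (n : ℕ)
    (x : WittVector p B) :
    ghostComponentMod hp n (WittVector.map (Ideal.Quotient.mk I) x) =
      Ideal.Quotient.mk _ (WittVector.ghostComponent n x) :=
  RingHom.liftOfSurjective_comp_apply ..

theorem WittVector.ghostComponentMod_teichmuller_mk {I : Ideal B} (hp : (p : B) ∈ I) (n : ℕ)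
    (b : B) :
    ghostComponentMod hp n (teichmuller p (Ideal.Quotient.mk I b)) =
      Ideal.Quotient.mk _ (b ^ p ^ n) := by
  rw [← WittVector.map_teichmuller, ghostComponentMod_map_mk, ghostComponent_teichmuller]

/-- A homomorphism from a perfect field `k` to a residue ring `B / I`, with `p ∈ I`, lifts to
homomorphisms `W(k) → B / I ^ (n + 1)`. -/
noncomputable def WittVector.liftMod {I : Ideal B} (hp : (p : B) ∈ I) (φ : k →+* B ⧸ I) (n : ℕ) :
    WittVector p k →+* B ⧸ I ^ (n + 1) :=
  (ghostComponentMod hp n).comp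
    ((WittVector.map φ).comp (WittVector.map ((iterateFrobeniusEquiv k p n).symm : k →+* k)))

/-- The classical construction of multiplicative representatives: take a `p ^ n`-th root in `k`,
lift it arbitrarily, and raise it to the power `p ^ n`. -/
theorem WittVector.liftMod_teichmuller {I : Ideal B} (hp : (p : B) ∈ I) (φ : k →+* B ⧸ I) (n : ℕ)
    (a : k) (b : B) (hb : Ideal.Quotient.mk I b = φ ((iterateFrobeniusEquiv k p n).symm a)) :
    liftMod hp φ n (teichmuller p a) = Ideal.Quotient.mk _ (b ^ p ^ n) := by
  simp only [liftMod, RingHom.comp_apply, WittVector.map_teichmuller]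
  rw [← ghostComponentMod_teichmuller_mk hp, hb]
  rfl

/-- Since `p` is nilpotent in the target, it suffices to compare values on Teichmüller elements. If
`b` lifts the `p ^ (n + 1)`-th root of `a`, then `b ^ p` lifts the `p ^ n`-th root. -/
theorem WittVector.factorPowSucc_comp_liftMod {I : Ideal B} (hp : (p : B) ∈ I) (φ : k →+* B ⧸ I)
    (n : ℕ) :
    (Ideal.Quotient.factorPowSucc I (n + 1)).comp (liftMod hp φ (n + 1)) = liftMod hp φ n := by
  refine eq_of_apply_teichmuller_eq _ _ ⟨n + 1, ?_⟩ fun a ↦ ?_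
  · rw [← map_natCast (Ideal.Quotient.mk (I ^ (n + 1))), ← map_pow,
      Ideal.Quotient.eq_zero_iff_mem]
    exact Ideal.pow_mem_pow hp _
  · obtain ⟨b, hb⟩ := Ideal.Quotient.mk_surjective (φ ((iterateFrobeniusEquiv k p (n + 1)).symm a))
    have hb' : Ideal.Quotient.mk I (b ^ p) = φ ((iterateFrobeniusEquiv k p n).symm a) := by
      rw [map_pow, hb, ← map_pow, add_comm n 1, iterateFrobeniusEquiv_symm_add_apply,
        ← iterateFrobeniusEquiv_one_apply, RingEquiv.apply_symm_apply]
    rw [RingHom.comp_apply, liftMod_teichmuller hp φ (n + 1) a b hb,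
      liftMod_teichmuller hp φ n a _ hb', ← pow_mul, ← pow_succ']
    simp

/-- If `B` is `I`-adically complete with `p ∈ I`, then a homomorphism from a perfect field `k` of
characteristic `p` to `B / I` lifts to a homomorphism `W(k) → B`. -/
theorem WittVector.exists_lift {I : Ideal B} [IsAdicComplete I B] (hp : (p : B) ∈ I)
    (φ : k →+* B ⧸ I) :
    ∃ ψ : WittVector p k →+* B, ∀ x, Ideal.Quotient.mk I (ψ x) = φ (x.coeff 0) := by
  refine ⟨IsAdicComplete.StrictMono.liftRingHom I Order.succ_strictMono (liftMod hp φ)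
    (factorPowSucc_comp_liftMod hp φ _), fun x ↦ ?_⟩
  have key : Ideal.Quotient.mk (I ^ (0 + 1)) (IsAdicComplete.StrictMono.liftRingHom I
      Order.succ_strictMono (liftMod hp φ) (factorPowSucc_comp_liftMod hp φ _) x) = liftMod hp φ 0 x :=
    IsAdicComplete.StrictMono.mk_liftRingHom I Order.succ_strictMono (liftMod hp φ)
      (factorPowSucc_comp_liftMod hp φ _) x
  obtain ⟨y, hy⟩ := WittVector.map_surjective (p := p) _ (Ideal.Quotient.mk_surjective (I := I))
    (WittVector.map φ x)
  have h0 : liftMod hp φ 0 x = Ideal.Quotient.mk _ (y.coeff 0) := by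
    have : liftMod hp φ 0 x = ghostComponentMod hp 0 (WittVector.map φ x) := by
      simp only [liftMod, RingHom.comp_apply]
      congr 2
      ext i
      simp [iterateFrobeniusEquiv_zero]
    rw [this, ← hy, ghostComponentMod_map_mk]
    simp [ghostComponent_apply]
  rw [h0, Ideal.Quotient.eq, zero_add, pow_one, ← Ideal.Quotient.eq] at key
  rw [key, ← WittVector.map_coeff, hy, WittVector.map_coeff]

/-- Each `p`-th power gains a factor in `I`: the cofactor of `x - y` in `x ^ p - y ^ p` is `p * y ^
(p - 1)` modulo `I`. -/
theorem Ideal.pow_prime_pow_sub_mem {B : Type*} [CommRing B] {p : ℕ} {I : Ideal B}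
    (hp : (p : B) ∈ I) {a b : B} (h : a - b ∈ I) (m : ℕ) : a ^ p ^ m - b ^ p ^ m ∈ I ^ (m + 1) := by
  induction m with
  | zero => simpa using h
  | succ m ih =>
    rw [pow_succ p m, pow_mul, pow_mul, ← geom_sum₂_mul, pow_succ' I]
    refine Ideal.mul_mem_mul ?_ ih
    have h1 : Ideal.Quotient.mk I (a ^ p ^ m) = Ideal.Quotient.mk I (b ^ p ^ m) :=
      Ideal.Quotient.eq.mpr (Ideal.pow_le_self m.succ_ne_zero ih)
    rw [← Ideal.Quotient.eq_zero_iff_mem]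
    simp only [map_sum, map_mul, map_pow] at h1 ⊢
    rw [h1, geom_sum₂_self, ← map_natCast (Ideal.Quotient.mk I),
      Ideal.Quotient.eq_zero_iff_mem.mpr hp, zero_mul]

/-- Two homomorphisms from `W(k)` to a ring that agree modulo a nilpotent ideal containing `p` are
equal. -/
theorem WittVector.ringHom_ext_of_nilpotent {I : Ideal B} {N : ℕ} (hI : I ^ N = ⊥)
    (hp : (p : B) ∈ I) (f g : WittVector p k →+* B)
    (h : ∀ x, f x - g x ∈ I) : f = g := by
  have hpow : ∀ m, (p : B) ^ m ∈ I ^ m := fun m ↦ Ideal.pow_mem_pow hp m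
  refine eq_of_apply_teichmuller_eq f g ⟨N, by simpa [hI] using hpow N⟩ fun a ↦ ?_
  set c : k := (iterateFrobeniusEquiv k p N).symm a
  have hc : c ^ p ^ N = a := by
    rw [← iterateFrobeniusEquiv_def k, RingEquiv.apply_symm_apply]
  have key := Ideal.pow_prime_pow_sub_mem hp (h (teichmuller p c)) N
  have := Ideal.pow_le_pow_right N.le_succ key
  rw [hI, Ideal.mem_bot, sub_eq_zero] at this
  rw [← hc, map_pow, map_pow, map_pow, this]

end WittLift

/-! ### Eisenstein extensions of complete discrete valuation rings. -/

section Eisenstein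

open IsLocalRing Polynomial

/-- A finite free module over a ring that is precomplete for a principal ideal is precomplete. -/
theorem IsPrecomplete.of_basis {W M ι : Type*} [CommRing W] [AddCommGroup M] [Module W M]
    [Finite ι] (b : Module.Basis ι W M) (ϖ : W) [IsPrecomplete (Ideal.span {ϖ}) W] :
    IsPrecomplete (Ideal.span {ϖ}) M := by
  cases nonempty_fintype ι
  have hW : ∀ (n : ℕ) (x y : W),
      x ≡ y [SMOD (Ideal.span {ϖ} ^ n • ⊤ : Submodule W W)] ↔ ϖ ^ n ∣ x - y := by
    intro n x y
    rw [SModEq.sub_mem, smul_eq_mul, Ideal.mul_top, Ideal.span_singleton_pow,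
      Ideal.mem_span_singleton]
  have hM : ∀ (n : ℕ) (x y : M), x ≡ y [SMOD (Ideal.span {ϖ} ^ n • ⊤ : Submodule W M)] ↔
      ∀ i, ϖ ^ n ∣ b.repr x i - b.repr y i := by
    intro n x y
    rw [SModEq.sub_mem, Ideal.span_singleton_pow, Submodule.ideal_span_singleton_smul]
    constructor
    · intro h i
      obtain ⟨z, -, hz⟩ := (Submodule.mem_smul_pointwise_iff_exists _ _ _).mp h
      exact ⟨b.repr z i, by rw [← Finsupp.sub_apply, ← map_sub, ← hz]; simp⟩
    · intro h
      choose c hc using h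
      refine (Submodule.mem_smul_pointwise_iff_exists _ _ _).mpr ⟨∑ i, c i • b i, trivial, ?_⟩
      apply b.repr.injective
      ext i
      rw [map_smul, Finsupp.smul_apply, b.repr_sum_self, smul_eq_mul, ← hc, map_sub,
        Finsupp.sub_apply]
  constructor
  intro f hf
  have : ∀ i, ∃ L : W, ∀ n, b.repr (f n) i ≡ L [SMOD (Ideal.span {ϖ} ^ n • ⊤ : Submodule W W)] :=
    fun i ↦ IsPrecomplete.prec' _ fun {m n} hmn ↦ (hW _ _ _).mpr ((hM _ _ _).mp (hf hmn) i)
  choose L hL using this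
  refine ⟨∑ i, L i • b i, fun n ↦ (hM _ _ _).mpr fun i ↦ ?_⟩
  have := (hW _ _ _).mp (hL i n)
  rwa [b.repr_sum_self]

variable {W : Type*} [CommRing W] [IsDomain W] [IsDiscreteValuationRing W] {f : W[X]}

theorem Polynomial.IsEisensteinAt.prime (hf : f.IsEisensteinAt (maximalIdeal W))
    (hm : f.Monic) (hd : f.natDegree ≠ 0) : Prime f :=
  (hf.irreducible inferInstance hm.isPrimitive (Nat.pos_of_ne_zero hd)).prime

/-- The constant term of `f` is `ϖ` times a unit, and it is a multiple of the root in the quotient.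
-/
theorem Polynomial.IsEisensteinAt.of_mem_span_root (hf : f.IsEisensteinAt (maximalIdeal W))
    (hd : f.natDegree ≠ 0) {ϖ : W} (hϖ : Irreducible ϖ) :
    AdjoinRoot.of f ϖ ∈ Ideal.span {AdjoinRoot.root f} := by
  have h0 : f.coeff 0 ∈ maximalIdeal W := hf.mem (Nat.pos_of_ne_zero hd)
  rw [hϖ.maximalIdeal_eq, Ideal.mem_span_singleton] at h0
  obtain ⟨c, hc⟩ := h0
  have hcu : IsUnit c := by
    by_contra h
    have : c ∈ maximalIdeal W := h
    refine hf.notMem ?_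
    rw [hc, pow_two]
    exact Ideal.mul_mem_mul (by rw [hϖ.maximalIdeal_eq]; exact Ideal.mem_span_singleton_self _) this
  have h1 : AdjoinRoot.of f (f.coeff 0) ∈ Ideal.span {AdjoinRoot.root f} := by
    have h2 := congrArg (AdjoinRoot.mk f) (X_mul_divX_add f)
    rw [map_add, map_mul, AdjoinRoot.mk_X, AdjoinRoot.mk_C, AdjoinRoot.mk_self] at h2
    rw [eq_neg_of_add_eq_zero_right h2, neg_mem_iff]
    exact Ideal.mul_mem_right _ _ (Ideal.mem_span_singleton_self _)
  rw [hc, map_mul] at h1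
  exact (Ideal.mul_unit_mem_iff_mem _ (hcu.map _)).mp h1

theorem Polynomial.IsEisensteinAt.root_pow_mem (hf : f.IsEisensteinAt (maximalIdeal W))
    (hm : f.Monic) {ϖ : W} (hϖ : Irreducible ϖ) :
    AdjoinRoot.root f ^ f.natDegree ∈ Ideal.span {AdjoinRoot.of f ϖ} := by
  have h1 := hf.isWeaklyEisensteinAt.pow_natDegree_le_of_aeval_zero_of_monic_mem_map
    (S := AdjoinRoot f) (x := AdjoinRoot.root f) (by simp) hm f.natDegree
    natDegree_map_le
  rw [hϖ.maximalIdeal_eq, Ideal.map_span, Set.image_singleton] at h1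
  exact h1

/-- The root generates the kernel of a surjection to the residue field of `W`. By integrality over
`W` every maximal ideal contains `ϖ`, hence a power of the root, hence the root. -/
theorem Polynomial.IsEisensteinAt.isLocalRing (hf : f.IsEisensteinAt (maximalIdeal W))
    (hm : f.Monic) (hd : f.natDegree ≠ 0) :
    ∃ _ : IsLocalRing (AdjoinRoot f), maximalIdeal (AdjoinRoot f) = Ideal.span {AdjoinRoot.root f} := by
  obtain ⟨ϖ, hϖ⟩ := IsDiscreteValuationRing.exists_irreducible W
  have := AdjoinRoot.isDomain_of_prime (hf.prime hm hd)
  have := hm.finite_adjoinRoot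
  have hmax : (Ideal.span {AdjoinRoot.root f}).IsMaximal := by
    have h0 : f.eval₂ (residue W) 0 = 0 := by
      rw [eval₂_at_zero, residue_eq_zero_iff]
      exact hf.mem (Nat.pos_of_ne_zero hd)
    have hker : RingHom.ker (AdjoinRoot.lift (residue W) 0 h0) =
        Ideal.span {AdjoinRoot.root f} := by
      refine le_antisymm (fun x hx ↦ ?_) ?_
      · obtain ⟨g, rfl⟩ := AdjoinRoot.mk_surjective x
        rw [RingHom.mem_ker, AdjoinRoot.lift_mk, eval₂_at_zero, residue_eq_zero_iff,
          hϖ.maximalIdeal_eq, Ideal.mem_span_singleton] at hx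
        obtain ⟨c, hc⟩ := hx
        rw [← X_mul_divX_add g, map_add, map_mul, AdjoinRoot.mk_X, AdjoinRoot.mk_C, hc, map_mul]
        exact add_mem (Ideal.mul_mem_right _ _ (Ideal.mem_span_singleton_self _))
          (Ideal.mul_mem_right _ _ (hf.of_mem_span_root hd hϖ))
      · rw [Ideal.span_singleton_le_iff_mem, RingHom.mem_ker, AdjoinRoot.lift_root]
    rw [← hker]
    refine RingHom.ker_isMaximal_of_surjective _ fun y ↦ ?_
    obtain ⟨w, rfl⟩ := residue_surjective y
    exact ⟨AdjoinRoot.of f w, AdjoinRoot.lift_of _⟩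
  have huniq : ∀ I : Ideal (AdjoinRoot f), I.IsMaximal → I = Ideal.span {AdjoinRoot.root f} := by
    intro I hI
    have hc : (I.comap (algebraMap W (AdjoinRoot f))).IsMaximal :=
      Ideal.isMaximal_comap_of_isIntegral_of_isMaximal I
    have h1 : AdjoinRoot.of f ϖ ∈ I := by
      have : ϖ ∈ I.comap (algebraMap W (AdjoinRoot f)) := by
        rw [eq_maximalIdeal hc]; exact hϖ.not_isUnit
      exact this
    have h2 : AdjoinRoot.root f ∈ I := by
      refine hI.isPrime.mem_of_pow_mem f.natDegree ?_
      exact (Ideal.span_singleton_le_iff_mem _).mpr h1 (hf.root_pow_mem hm hϖ)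
    exact (hmax.eq_of_le hI.ne_top ((Ideal.span_singleton_le_iff_mem _).mpr h2)).symm
  refine ⟨IsLocalRing.of_unique_max_ideal ⟨_, hmax, huniq⟩, ?_⟩
  have := IsLocalRing.of_unique_max_ideal ⟨_, hmax, huniq⟩
  exact huniq _ inferInstance

/-- A Noetherian local domain with nonzero principal maximal ideal is a discrete valuation ring.
Completeness comes from freeness over `W`, because the `ϖ`-adic and `𝔪`-adic topologies coincide. -/
theorem Polynomial.IsEisensteinAt.isDiscreteValuationRing
    (hf : f.IsEisensteinAt (maximalIdeal W)) (hm : f.Monic) (hd : f.natDegree ≠ 0)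
    [IsAdicComplete (maximalIdeal W) W] :
    ∃ (_ : IsDomain (AdjoinRoot f)) (_ : IsDiscreteValuationRing (AdjoinRoot f)),
      maximalIdeal (AdjoinRoot f) = Ideal.span {AdjoinRoot.root f} ∧
      IsAdicComplete (maximalIdeal (AdjoinRoot f)) (AdjoinRoot f) := by
  obtain ⟨ϖ, hϖ⟩ := IsDiscreteValuationRing.exists_irreducible W
  have := AdjoinRoot.isDomain_of_prime (hf.prime hm hd)
  have := hm.finite_adjoinRoot
  have : IsNoetherianRing (AdjoinRoot f) := inferInstance
  obtain ⟨_, hmax⟩ := hf.isLocalRing hm hd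
  have hinj : Function.Injective (AdjoinRoot.of f) :=
    AdjoinRoot.of.injective_of_degree_ne_zero fun h ↦ hd (natDegree_eq_of_degree_eq_some h)
  have hne : maximalIdeal (AdjoinRoot f) ≠ ⊥ := by
    rw [hmax]
    intro h
    have h1 := hf.of_mem_span_root hd hϖ
    rw [h, Ideal.mem_bot] at h1
    exact hϖ.ne_zero (hinj (by rw [h1, map_zero]))
  have hnf : ¬ IsField (AdjoinRoot f) := by
    rwa [IsLocalRing.isField_iff_maximalIdeal_eq]
  have hprin : (maximalIdeal (AdjoinRoot f)).IsPrincipal := ⟨⟨_, hmax⟩⟩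
  have hdvr : IsDiscreteValuationRing (AdjoinRoot f) :=
    ((IsDiscreteValuationRing.TFAE (AdjoinRoot f) hnf).out 0 4).mpr hprin
  refine ⟨inferInstance, hdvr, hmax, ?_⟩
  have hp : IsPrecomplete (maximalIdeal (AdjoinRoot f)) (AdjoinRoot f) := by
    have : IsPrecomplete (Ideal.span {ϖ}) W := by
      rw [← hϖ.maximalIdeal_eq]; infer_instance
    have := IsPrecomplete.of_basis (AdjoinRoot.powerBasis' hm).basis ϖ
    rw [← IsPrecomplete.map_algebraMap_iff (S := AdjoinRoot f), Ideal.map_span,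
      Set.image_singleton] at this
    have hle : Ideal.span {algebraMap W (AdjoinRoot f) ϖ} ≤ maximalIdeal (AdjoinRoot f) := by
      rw [Ideal.span_singleton_le_iff_mem, hmax]
      exact hf.of_mem_span_root hd hϖ
    have hge : maximalIdeal (AdjoinRoot f) ^ f.natDegree ≤
        Ideal.span {algebraMap W (AdjoinRoot f) ϖ} := by
      rw [hmax, Ideal.span_singleton_pow, Ideal.span_singleton_le_iff_mem]
      exact hf.root_pow_mem hm hϖ
    constructor
    intro s hs
    simp only [SModEq.sub_mem, smul_eq_mul, Ideal.mul_top] at hs ⊢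
    -- As `𝔪 ^ e ⊆ (ϖ)` for `e = deg f`, the subsequence of indices `e * n` is Cauchy for the
    -- `ϖ`-adic topology.
    obtain ⟨L, hL⟩ := this.prec' (fun n ↦ s (f.natDegree * n)) (by
      intro m n hmn
      simp only [SModEq.sub_mem, smul_eq_mul, Ideal.mul_top]
      refine Ideal.pow_right_mono hge m ?_
      rw [← pow_mul]
      exact hs (Nat.mul_le_mul_left _ hmn))
    simp only [SModEq.sub_mem, smul_eq_mul, Ideal.mul_top] at hL
    refine ⟨L, fun n ↦ ?_⟩
    rw [← sub_add_sub_cancel _ (s (f.natDegree * n)) L]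
    exact add_mem (hs (Nat.le_mul_of_pos_left _ (Nat.pos_of_ne_zero hd)))
      (Ideal.pow_right_mono hle n (hL n))
  have hh : IsHausdorff (maximalIdeal (AdjoinRoot f)) (AdjoinRoot f) := inferInstance
  exact { hh, hp with }

end Eisenstein

/-! ### Hensel's lemma by contraction. -/

section Hensel

open IsLocalRing Polynomial

/-- A self-map of a complete ring that brings points of `I` closer together `I`-adically has a
fixed point in `I`. -/
theorem IsAdicComplete.exists_fixedPoint {S : Type*} [CommRing S] {I : Ideal S}
    [IsAdicComplete I S] (Φ : S → S) (hmem : ∀ s ∈ I, Φ s ∈ I)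
    (hcontr : ∀ n, ∀ s ∈ I, ∀ t ∈ I, s - t ∈ I ^ n → Φ s - Φ t ∈ I ^ (n + 1)) :
    ∃ s ∈ I, Φ s = s := by
  let a : ℕ → S := fun n ↦ Φ^[n] 0
  have ha : ∀ n, a (n + 1) = Φ (a n) := fun n ↦ Function.iterate_succ_apply' _ _ _
  have haI : ∀ n, a n ∈ I := by
    intro n
    induction n with
    | zero => exact I.zero_mem
    | succ n ih => rw [ha]; exact hmem _ ih
  have hstep : ∀ n, a n - a (n + 1) ∈ I ^ n := by
    intro n
    induction n with
    | zero => simp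
    | succ n ih => rw [ha, ha (n + 1)]; exact hcontr n _ (haI _) _ (haI _) ih
  have hcauchy : ∀ {m n}, m ≤ n → a m - a n ∈ I ^ m := by
    intro m n hmn
    induction n, hmn using Nat.le_induction with
    | base => simp
    | succ n hmn ih =>
      rw [← sub_add_sub_cancel _ (a n)]
      exact add_mem ih (Ideal.pow_le_pow_right hmn (hstep n))
  obtain ⟨L, hL⟩ := IsPrecomplete.prec' (I := I) a (by
    intro m n hmn
    simpa only [SModEq.sub_mem, smul_eq_mul, Ideal.mul_top] using hcauchy hmn)
  simp only [SModEq.sub_mem, smul_eq_mul, Ideal.mul_top] at hL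
  have hLI : L ∈ I := by
    have h1 := hL 1
    rw [pow_one] at h1
    simpa using sub_mem (haI 1) h1
  refine ⟨L, hLI, ?_⟩
  rw [← sub_eq_zero]
  refine IsHausdorff.haus' (I := I) _ fun n ↦ ?_
  simp only [SModEq.zero, smul_eq_mul, Ideal.mul_top]
  rw [← sub_add_sub_cancel _ (a (n + 1)) L]
  refine add_mem ?_ (Ideal.pow_le_pow_right n.le_succ (hL _))
  rw [ha, ← neg_sub, neg_mem_iff]
  exact Ideal.pow_le_pow_right n.le_succ (hcontr n _ (haI n) _ hLI (hL n))

/-- Hensel's lemma for possibly multiple residual roots and possibly non-monic polynomials. -/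
theorem IsAdicComplete.exists_root_of_eval_eq_sq_mul {S : Type*} [CommRing S] {I : Ideal S}
    [IsAdicComplete I S] (g : S[X]) (a m : S) (hm : m ∈ I)
    (h : g.eval a = g.derivative.eval a ^ 2 * m) : ∃ z, g.eval z = 0 ∧ z - a ∈ I := by
  set b := g.derivative.eval a with hb
  set T := (taylor a g).divX.divX
  have hT : ∀ t, g.eval (t + a) = b ^ 2 * m + (b + T.eval t * t) * t := by
    intro t
    rw [← taylor_eval, ← divX_mul_X_add (taylor a g), ← divX_mul_X_add (taylor a g).divX]
    simp [taylor_coeff_zero, taylor_coeff_one, ← hb, h, T]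
    ring
  -- Substituting `t = b * s` turns `g(t + a)` into `b ^ 2 * (m + s + s ^ 2 * T(b * s))`, so a fixed
  -- point of this map gives a root.
  obtain ⟨s, hs, hfix⟩ := IsAdicComplete.exists_fixedPoint (I := I)
    (fun s ↦ -(m + s ^ 2 * T.eval (b * s)))
    (fun s hs ↦ neg_mem (add_mem hm (I.mul_mem_right _ (I.pow_mem_of_mem hs 2 two_pos))))
    (fun n s hs t ht hst ↦ by
      obtain ⟨c, hc⟩ := sub_dvd_eval_sub (b * s) (b * t) T
      have h1 : -(m + s ^ 2 * T.eval (b * s)) - -(m + t ^ 2 * T.eval (b * t)) =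
          (s - t) * (-(s * (s * b * c) + (s + t) * T.eval (b * t))) := by
        linear_combination -s ^ 2 * hc
      rw [h1, pow_succ]
      exact Ideal.mul_mem_mul hst (neg_mem (add_mem (I.mul_mem_right _ hs)
        (I.mul_mem_right _ (add_mem hs ht)))))
  refine ⟨b * s + a, ?_, by simpa using I.mul_mem_left b hs⟩
  rw [hT]
  linear_combination -b ^ 2 * hfix

end Hensel

/-! ### Valuations of sums with distinct terms. -/

section Valuation

open IsLocalRing Polynomial

/-- Coincidence at `⊤` is permitted so that vanishing terms need no separate treatment. -/
theorem AddValuation.map_sum_eq_inf {R Γ ι : Type*} [Ring R]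
    [LinearOrderedAddCommMonoidWithTop Γ] (v : AddValuation R Γ) (s : Finset ι) (t : ι → R)
    (h : ∀ i ∈ s, ∀ j ∈ s, i ≠ j → v (t i) = v (t j) → v (t i) = ⊤) :
    v (∑ i ∈ s, t i) = s.inf fun i ↦ v (t i) := by
  classical
  induction s using Finset.induction with
  | empty => simp
  | insert a s ha ih =>
    have ih := ih fun i hi j hj ↦ h i (Finset.mem_insert_of_mem hi) j (Finset.mem_insert_of_mem hj)
    rw [Finset.sum_insert ha, Finset.inf_insert, ← ih]
    by_cases hne : v (t a) = v (∑ i ∈ s, t i)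
    · have htop : v (t a) = ⊤ := by
        rcases s.eq_empty_or_nonempty with rfl | hs
        · simpa using hne
        · obtain ⟨j, hj, hj'⟩ := Finset.exists_mem_eq_inf s hs fun i ↦ v (t i)
          exact h a (Finset.mem_insert_self _ _) j (Finset.mem_insert_of_mem hj)
            (fun e ↦ ha (e ▸ hj)) (by rw [hne, ih, hj'])
      rw [← hne, htop, inf_top_eq, ← top_le_iff]
      have := v.map_add (t a) (∑ i ∈ s, t i)
      rwa [← hne, htop, min_self] at this
    · exact v.map_add_of_distinct_val hne

open IsDiscreteValuationRing in
/-- In a discrete valuation ring `S` of ramification index `e` over `W`, an expression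
`∑ i < e, c i * b i * y ^ i` with `b i ∈ W`, units `c i` and a uniformizer `y` has at most the
valuation of its term of index `0`. -/
theorem IsDiscreteValuationRing.addVal_sum_mul_pow_le {W S : Type*} [CommRing W] [IsDomain W]
    [IsDiscreteValuationRing W] [CommRing S] [IsDomain S] [IsDiscreteValuationRing S]
    (ψ : W →+* S) {ϖ : W} (hϖ : Irreducible ϖ) {y : S} (hy : Irreducible y) {e : ℕ} (he : 0 < e)
    (hψ : addVal S (ψ ϖ) = e) (b : ℕ → W) (c : ℕ → Sˣ) :
    addVal S (∑ i ∈ Finset.range e, c i * ψ (b i) * y ^ i) ≤ addVal S (ψ (b 0)) := by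
  -- Values on the image of `W` are multiples of `e`, so the finite valuations of the terms lie in
  -- distinct classes modulo `e`.
  have hval : ∀ w : W, addVal S (ψ w) = ⊤ ∨ ∃ m : ℕ, addVal S (ψ w) = (e * m : ℕ) := by
    intro w
    rcases eq_or_ne w 0 with rfl | hw
    · left; simp
    · right
      obtain ⟨m, u, rfl⟩ := eq_unit_mul_pow_irreducible hw hϖ
      refine ⟨m, ?_⟩
      have : IsUnit (ψ u) := u.isUnit.map ψ
      rw [map_mul, map_pow, addVal_mul, addVal_pow, hψ, addVal_eq_zero_iff.mpr this]
      simp [mul_comm]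
  have hterm : ∀ i, addVal S (c i * ψ (b i) * y ^ i) = addVal S (ψ (b i)) + i := by
    intro i
    rw [addVal_mul, addVal_mul, addVal_eq_zero_of_unit, hy.addVal_pow, zero_add]
  rw [AddValuation.map_sum_eq_inf]
  · refine (Finset.inf_le (Finset.mem_range.mpr he)).trans ?_
    rw [hterm]
    simp
  · intro i hi j hj hij hv
    rw [Finset.mem_range] at hi hj
    rw [hterm, hterm] at hv
    rw [hterm]
    rcases hval (b i) with hi' | ⟨m, hm⟩
    · rw [hi', top_add]
    rcases hval (b j) with hj' | ⟨m', hm'⟩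
    · rw [hv, hj', top_add]
    rw [hm, hm'] at hv
    exfalso
    have hv : e * m + i = e * m' + j := by exact_mod_cast hv
    have := congrArg (· % e) hv
    simp only [Nat.mul_add_mod, Nat.mod_eq_of_lt hi, Nat.mod_eq_of_lt hj] at this
    exact hij this

open IsDiscreteValuationRing in
theorem IsDiscreteValuationRing.mem_maximalIdeal_pow_iff {S : Type*} [CommRing S] [IsDomain S]
    [IsDiscreteValuationRing S] {x : S} {n : ℕ} :
    x ∈ IsLocalRing.maximalIdeal S ^ n ↔ (n : ℕ∞) ≤ addVal S x := by
  obtain ⟨y, hy⟩ := exists_irreducible S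
  rw [hy.maximalIdeal_eq, Ideal.span_singleton_pow, Ideal.mem_span_singleton,
    ← addVal_le_iff_dvd, hy.addVal_pow]

open IsDiscreteValuationRing in
theorem IsDiscreteValuationRing.addVal_eq_of_span_eq {S : Type*} [CommRing S] [IsDomain S]
    [IsDiscreteValuationRing S] {x : S} {n : ℕ} (h : Ideal.span {x} = IsLocalRing.maximalIdeal S ^ n) :
    addVal S x = n := by
  obtain ⟨y, hy⟩ := exists_irreducible S
  rw [hy.maximalIdeal_eq, Ideal.span_singleton_pow, Ideal.span_singleton_eq_span_singleton] at h
  rw [(addVal_eq_iff_associated _ _).mpr h, hy.addVal_pow]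

end Valuation

/-! ### Refining approximate roots of Eisenstein polynomials. -/

section EisensteinRoot

open IsLocalRing Polynomial

theorem Polynomial.mul_eval_derivative_eq_sum {R : Type*} [CommSemiring R] (q : R[X]) {e : ℕ}
    (hq : q.natDegree < e) (y : R) :
    y * q.derivative.eval y = ∑ i ∈ Finset.range e, q.coeff i * i * y ^ i := by
  conv_lhs => rw [q.as_sum_range' e hq]
  rw [derivative_sum, eval_finsetSum, Finset.mul_sum]
  refine Finset.sum_congr rfl fun i _ ↦ ?_
  rw [derivative_monomial, eval_monomial]
  rcases i with _ | i
  · simp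
  · rw [Nat.add_sub_cancel]; ring

variable {W S : Type*} [CommRing W] [IsDomain W] [IsDiscreteValuationRing W] [CommRing S]
  [IsDomain S] [IsDiscreteValuationRing S]

open IsDiscreteValuationRing in
/-- An approximate root of an Eisenstein polynomial in a complete discrete valuation ring that is a
uniformizer can be refined to a root. -/
theorem IsDiscreteValuationRing.exists_unit_eval₂_mul_eq_zero
    [IsAdicComplete (IsLocalRing.maximalIdeal S) S] (ψ : W →+* S) {ϖ : W} (hϖ : Irreducible ϖ)
    {y : S} (hy : Irreducible y) {q : W[X]} {e r n : ℕ} (hq : q.natDegree < e)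
    (hψ : addVal S (ψ ϖ) = e) (her : addVal S (e : S) = r)
    (hf : (X ^ e - C ϖ * q).eval₂ ψ y ∈ IsLocalRing.maximalIdeal S ^ n) (hn : e + 2 * r < n) :
    ∃ z : S, IsUnit z ∧ (X ^ e - C ϖ * q).eval₂ ψ (y * z) = 0 := by
  have he : 0 < e := by omega
  obtain ⟨u, hu⟩ : Associated (y ^ e) (ψ ϖ) := by
    rw [← addVal_eq_iff_associated, hy.addVal_pow, hψ]
  -- This is `f(y t) / y ^ e`, where `f = X ^ e - ϖ q`; the division makes `t = 1` an approximate
  -- root with derivative of small valuation.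
  set g : S[X] := X ^ e - C (u : S) * (q.map ψ).comp (C y * X) with hg
  have hgf : ∀ t, y ^ e * g.eval t = (X ^ e - C ϖ * q).eval₂ ψ (y * t) := by
    intro t
    simp only [hg, eval_sub, eval_mul, eval_pow, eval_X, eval_C, eval_comp, eval₂_sub, eval₂_mul,
      eval₂_pow, eval₂_X, eval₂_C, eval_map, ← hu]
    ring
  have hd : g.derivative.eval 1 = e - u * (y * (q.map ψ).derivative.eval y) := by
    simp [hg, derivative_comp, derivative_X_pow]
  -- In `g'(1) = e - u * y q'(y)` the integer `e` is the term of index `0`, and the terms of `y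
  -- q'(y)` have indices `1, …, e - 1`, so nothing cancels it.
  have hdr : addVal S (g.derivative.eval 1) ≤ r := by
    obtain ⟨d, rfl⟩ : ∃ d, e = d + 1 := ⟨e - 1, by omega⟩
    have := addVal_sum_mul_pow_le ψ hϖ hy he hψ
      (fun i ↦ if i = 0 then ((d + 1 : ℕ) : W) else q.coeff i * i) (fun i ↦ if i = 0 then 1 else -u)
    rw [if_pos rfl, map_natCast, her] at this
    convert this using 2
    rw [hd, mul_eval_derivative_eq_sum _ (natDegree_map_le.trans_lt hq), Finset.sum_range_succ',
      Finset.sum_range_succ' (n := d), mul_add, Finset.mul_sum]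
    simp only [Nat.succ_ne_zero, if_false, if_true, coeff_map, map_mul, map_natCast, Units.val_neg,
      Units.val_one, pow_zero, Nat.cast_zero, mul_zero, add_zero, one_mul, mul_one]
    rw [sub_eq_neg_add, ← Finset.sum_neg_distrib]
    congr 1
    exact Finset.sum_congr rfl fun i _ ↦ by ring
  have hg1 : (n : ℕ∞) ≤ e + addVal S (g.eval 1) := by
    rw [← hy.addVal_pow e, ← addVal_mul, hgf, mul_one]
    exact mem_maximalIdeal_pow_iff.mp hf
  -- Here `n - e ≥ 2 r + 1`; the extra factor `y` places the Hensel error term in the maximal ideal.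
  obtain ⟨c, hc⟩ : g.derivative.eval 1 ^ 2 * y ∣ g.eval 1 := by
    rw [← addVal_le_iff_dvd, addVal_mul, addVal_pow, addVal_uniformizer hy, two_nsmul]
    generalize addVal S (g.derivative.eval 1) = a at hdr ⊢
    generalize addVal S (g.eval 1) = b at hg1 ⊢
    induction b using ENat.recTopCoe with
    | top => exact le_top
    | coe b =>
      induction a using ENat.recTopCoe with
      | top => simp at hdr
      | coe a =>
        norm_cast at hdr hg1 ⊢
        omega
  obtain ⟨z, hz, hz1⟩ := IsAdicComplete.exists_root_of_eval_eq_sq_mul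
    (I := IsLocalRing.maximalIdeal S) g 1 (y * c)
    (Ideal.mul_mem_right _ _ hy.not_isUnit) (by rw [hc]; ring)
  refine ⟨z, ?_, by rw [← hgf, hz, mul_zero]⟩
  by_contra hzu
  have hzm : z ∈ IsLocalRing.maximalIdeal S := hzu
  exact (Ideal.ne_top_iff_one _).mp (IsLocalRing.maximalIdeal.isMaximal S).ne_top
    (by simpa using sub_mem hzm hz1)

theorem Polynomial.monic_and_natDegree_X_pow_sub_C_mul {R : Type*} [CommRing R] [Nontrivial R] {q : R[X]}
    {e : ℕ} (hq : q.natDegree < e) (a : R) :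
    (X ^ e - C a * q).Monic ∧ (X ^ e - C a * q).natDegree = e := by
  have hlt : (C a * q).natDegree < e := (natDegree_C_mul_le _ _).trans_lt hq
  have hdeg : (C a * q).degree < e := degree_le_natDegree.trans_lt (by exact_mod_cast hlt)
  refine ⟨monic_X_pow_sub (n := e) hdeg, ?_⟩
  rw [natDegree_sub_eq_left_of_natDegree_lt (by rwa [natDegree_X_pow]), natDegree_X_pow]

theorem Polynomial.isEisensteinAt_X_pow_sub_C_mul {q : W[X]} {e : ℕ} (hq : q.natDegree < e)
    {ϖ : W} (hϖ : Irreducible ϖ) (h0 : IsUnit (q.coeff 0)) :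
    (X ^ e - C ϖ * q).IsEisensteinAt (maximalIdeal W) := by
  obtain ⟨hm, hd⟩ := monic_and_natDegree_X_pow_sub_C_mul hq ϖ
  have hmem : ϖ ∈ maximalIdeal W := hϖ.not_isUnit
  refine hm.isEisensteinAt_of_mem_of_notMem (maximalIdeal.isMaximal W).ne_top (fun {i} hi ↦ ?_) ?_
  · rw [hd] at hi
    rw [coeff_sub, coeff_X_pow, if_neg hi.ne, coeff_C_mul, zero_sub, neg_mem_iff]
    exact Ideal.mul_mem_right _ _ hmem
  · rw [coeff_sub, coeff_X_pow, if_neg (by omega), coeff_C_mul, zero_sub, neg_mem_iff,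
      Ideal.mul_unit_mem_iff_mem _ h0, hϖ.maximalIdeal_eq, Ideal.span_singleton_pow,
      Ideal.mem_span_singleton]
    intro h
    have : 2 ≤ 1 := (pow_dvd_pow_iff hϖ.ne_zero hϖ.not_isUnit).mp (by rwa [pow_one])
    omega

end EisensteinRoot

/-! ### Local rings and their quotients. -/

section LocalRings

open IsLocalRing Polynomial

theorem IsAdicComplete.of_pow_eq_bot {A : Type*} [CommRing A] {I : Ideal A} {n : ℕ}
    (h : I ^ n = ⊥) : IsAdicComplete I A where
  haus' x hx := by simpa [SModEq.zero, h] using hx n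
  prec' s hs := by
    simp only [SModEq.sub_mem, smul_eq_mul, Ideal.mul_top] at hs ⊢
    refine ⟨s n, fun m ↦ ?_⟩
    rcases le_total m n with hmn | hmn
    · exact hs hmn
    · have := hs hmn
      rw [h, Ideal.mem_bot, sub_eq_zero] at this
      simp [this]

theorem IsLocalRing.exists_span_singleton_eq_pow {A : Type*} [CommRing A] [IsLocalRing A] {π : A}
    (hπ : maximalIdeal A = Ideal.span {π}) {n : ℕ} (hn : maximalIdeal A ^ n = ⊥) (a : A) :
    ∃ k, Ideal.span {a} = maximalIdeal A ^ k := by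
  classical
  by_cases ha : a = 0
  · exact ⟨n, by rw [hn, ha, Ideal.span_singleton_eq_bot]⟩
  have hex : ∃ k, a ∉ maximalIdeal A ^ k := ⟨n, by rwa [hn, Ideal.mem_bot]⟩
  obtain ⟨k, hk⟩ : ∃ k, Nat.find hex = k + 1 :=
    Nat.exists_eq_succ_of_ne_zero fun h0 ↦ by
      have := Nat.find_spec hex
      simp [h0] at this
  have hmem : a ∈ maximalIdeal A ^ k := not_not.mp (Nat.find_min hex (by omega))
  have hnot : a ∉ maximalIdeal A ^ (k + 1) := hk ▸ Nat.find_spec hex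
  refine ⟨k, ?_⟩
  rw [hπ, Ideal.span_singleton_pow, Ideal.mem_span_singleton] at hmem
  obtain ⟨c, rfl⟩ := hmem
  have hc : IsUnit c := by
    by_contra hc
    have hc : c ∈ maximalIdeal A := hc
    refine hnot ?_
    rw [pow_succ]
    exact Ideal.mul_mem_mul (Ideal.pow_mem_pow (hπ ▸ Ideal.mem_span_singleton_self π) k) hc
  rw [hπ, Ideal.span_singleton_pow, Ideal.span_singleton_mul_right_unit hc]

/-- The equality holds modulo `𝔪 ^ n ⊆ 𝔪 ^ (j + 1)`, so Nakayama's lemma removes the error. It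
transfers the valuations of `p`, `e` and a lift of `π` from `A` to `S`. -/
theorem IsLocalRing.span_singleton_eq_pow_of_surjective {S A : Type*} [CommRing S] [IsLocalRing S]
    [IsNoetherianRing S] [CommRing A] [IsLocalRing A] {θ : S →+* A} (hθ : Function.Surjective θ)
    {n j : ℕ} (hker : RingHom.ker θ = maximalIdeal S ^ n) (hj : j < n) {x : S}
    (hx : Ideal.span {θ x} = maximalIdeal A ^ j) : Ideal.span {x} = maximalIdeal S ^ j := by
  have h1 : (Ideal.span {x}).map θ = (maximalIdeal S ^ j).map θ := by
    rw [Ideal.map_span, Set.image_singleton, hx, Ideal.map_pow,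
      map_maximalIdeal_of_surjective θ hθ]
  have h2 := congrArg (Ideal.comap θ) h1
  rw [Ideal.comap_map_of_surjective θ hθ, Ideal.comap_map_of_surjective θ hθ,
    ← RingHom.ker_eq_comap_bot, hker, sup_eq_left.mpr (Ideal.pow_le_pow_right hj.le : maximalIdeal S ^ n ≤ maximalIdeal S ^ j)] at h2
  refine le_antisymm (le_sup_left.trans h2.le) ?_
  refine Submodule.le_of_le_smul_of_le_jacobson_bot (I := maximalIdeal S)
    (IsNoetherian.noetherian _) (IsLocalRing.maximalIdeal_le_jacobson _) ?_
  rw [smul_eq_mul, ← pow_succ']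
  exact h2.ge.trans (sup_le_sup_left (Ideal.pow_le_pow_right hj) _)

theorem IsDiscreteValuationRing.ker_eq_pow {R A : Type*} [CommRing R] [IsDomain R]
    [IsDiscreteValuationRing R] [CommRing A] [IsLocalRing A] {θ : R →+* A}
    (hθ : Function.Surjective θ) {n : ℕ} (hn : IsLocalRing.maximalIdeal A ^ n = ⊥)
    (hn' : IsLocalRing.maximalIdeal A ^ (n - 1) ≠ ⊥) :
    RingHom.ker θ = IsLocalRing.maximalIdeal R ^ n := by
  obtain ⟨x, hx⟩ := exists_irreducible R
  have hle : ∀ j, IsLocalRing.maximalIdeal R ^ j ≤ RingHom.ker θ ↔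
      IsLocalRing.maximalIdeal A ^ j = ⊥ := by
    intro j
    rw [← map_maximalIdeal_of_surjective θ hθ, ← Ideal.map_pow, Ideal.map_eq_bot_iff_le_ker]
  have hne : RingHom.ker θ ≠ ⊥ := by
    intro h
    have := (hle n).mpr hn
    rw [h, le_bot_iff] at this
    exact not_a_field R (eq_zero_of_pow_eq_zero this)
  obtain ⟨N, hN⟩ := ideal_eq_span_pow_irreducible hne hx
  rw [← Ideal.span_singleton_pow, ← hx.maximalIdeal_eq] at hN
  have h1 : N ≤ n := by
    have := (hle n).mpr hn
    rw [hN, hx.maximalIdeal_eq, Ideal.span_singleton_pow, Ideal.span_singleton_pow,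
      Ideal.span_singleton_le_span_singleton] at this
    exact (pow_dvd_pow_iff hx.ne_zero hx.not_isUnit).mp this
  have h2 : ¬ N ≤ n - 1 := fun h ↦
    hn' ((hle _).mp (by rw [hN]; exact Ideal.pow_le_pow_right h))
  have h3 : N = n := by
    by_contra h
    omega
  rw [hN, h3]

/-- In a positive characteristic `q ≠ p`, coprimality would make `p` a unit. -/
theorem IsLocalRing.charZero_of_prime_mem {R : Type*} [CommRing R] [IsDomain R] [IsLocalRing R]
    {p : ℕ} (hp : p.Prime) (hmem : (p : R) ∈ maximalIdeal R) (h0 : (p : R) ≠ 0) : CharZero R := by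
  obtain ⟨q, hq⟩ := CharP.exists R
  rcases CharP.char_is_prime_or_zero R q with hq' | rfl
  · exfalso
    have hne : p ≠ q := by
      rintro rfl
      exact h0 (CharP.cast_eq_zero R p)
    have hcop : IsCoprime (p : R) (q : R) := by
      simpa using (Nat.isCoprime_iff_coprime.mpr ((Nat.coprime_primes hp hq').mpr hne)).map
        (Int.castRingHom R)
    rw [CharP.cast_eq_zero R q, isCoprime_zero_right] at hcop
    exact hmem hcop
  · exact CharP.charP_to_charZero R

/-- A homomorphism of complete discrete valuation rings that maps a uniformizer to a uniformizer
and is surjective on residue fields is an isomorphism. -/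
theorem IsDiscreteValuationRing.bijective_of_map_maximalIdeal {R S : Type*} [CommRing R]
    [IsDomain R] [IsDiscreteValuationRing R] [CommRing S] [IsDomain S] [IsDiscreteValuationRing S]
    [IsAdicComplete (IsLocalRing.maximalIdeal R) R] (h : R →+* S)
    (hmap : (IsLocalRing.maximalIdeal R).map h = IsLocalRing.maximalIdeal S)
    (hres : ∀ s, ∃ r, s - h r ∈ IsLocalRing.maximalIdeal S) : Function.Bijective h := by
  constructor
  -- A nonzero prime kernel would be the maximal ideal, making the maximal ideal of `S` zero.
  · rw [RingHom.injective_iff_ker_eq_bot]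
    by_contra hne
    have hprime : (RingHom.ker h).IsPrime := RingHom.ker_isPrime h
    have := hprime.isMaximal hne
    have hle := (IsLocalRing.eq_maximalIdeal this).ge
    rw [← Ideal.map_eq_bot_iff_le_ker, hmap] at hle
    exact not_a_field S hle
  · have : IsHausdorff ((IsLocalRing.maximalIdeal R).map h) S := by
      rw [hmap]; infer_instance
    refine surjective_of_mk_map_comp_surjective (I := IsLocalRing.maximalIdeal R) h fun s ↦ ?_
    obtain ⟨s, rfl⟩ := Ideal.Quotient.mk_surjective s
    obtain ⟨r, hr⟩ := hres s
    exact ⟨r, ((Ideal.Quotient.mk_eq_mk_iff_sub_mem _ _).mpr (by rwa [hmap])).symm⟩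

end LocalRings

/-! ### Eisenstein presentation of a principal local ring. -/

section Presentation

open IsLocalRing Polynomial

variable {W A : Type*} [CommRing W] [CommRing A] {ψ : W →+* A} {π : A}

theorem exists_sub_eval₂_mem_span_pow (hψ : ∀ a, ∃ w, π ∣ a - ψ w) (j : ℕ) (a : A) :
    ∃ q : W[X], q.degree < j ∧ π ^ j ∣ a - q.eval₂ ψ π := by
  induction j with
  | zero => exact ⟨0, by simp⟩
  | succ j ih =>
    obtain ⟨q, hq, c, hc⟩ := ih
    obtain ⟨w, d, hd⟩ := hψ c
    refine ⟨q + C w * X ^ j, ?_, d, ?_⟩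
    · refine (degree_add_le _ _).trans_lt (max_lt (hq.trans (by exact_mod_cast j.lt_succ_self)) ?_)
      exact (degree_C_mul_X_pow_le _ _).trans_lt (by exact_mod_cast j.lt_succ_self)
    · simp only [eval₂_add, eval₂_mul, eval₂_C, eval₂_pow, eval₂_X]
      linear_combination hc + π ^ j * hd

/-- Expansion to `e` digits in `π` leaves a remainder divisible by `ψ ϖ`; iterating on the quotient
stops because `ψ ϖ` is nilpotent. -/
theorem exists_eq_eval₂_of_pow_dvd (hψ : ∀ a, ∃ w, π ∣ a - ψ w) {e N : ℕ} {ϖ : W}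
    (he : ψ ϖ ∣ π ^ e) (hN : ψ ϖ ^ N = 0) (a : A) :
    ∃ q : W[X], q.degree < e ∧ a = q.eval₂ ψ π := by
  suffices ∀ N, ∃ q : W[X], q.degree < e ∧ ψ ϖ ^ N ∣ a - q.eval₂ ψ π by
    obtain ⟨q, hq, h⟩ := this N
    rw [hN, zero_dvd_iff, sub_eq_zero] at h
    exact ⟨q, hq, h⟩
  clear hN
  intro N
  induction N with
  | zero => exact ⟨0, by simp [bot_lt_iff_ne_bot]⟩
  | succ N ih =>
    obtain ⟨q, hq, c, hc⟩ := ih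
    obtain ⟨q', hq', h'⟩ := exists_sub_eval₂_mem_span_pow hψ e c
    obtain ⟨d, hd⟩ := he.trans h'
    refine ⟨q + C (ϖ ^ N) * q', ?_, d, ?_⟩
    · refine (degree_add_le _ _).trans_lt (max_lt hq ?_)
      rw [← smul_eq_C_mul]
      exact (degree_smul_le _ _).trans_lt hq'
    · rw [eval₂_add, eval₂_mul, eval₂_C, map_pow]
      linear_combination hc + ψ ϖ ^ N * hd

/-- The polynomial `q` expands the cofactor of `ψ ϖ` in `π ^ e`. Were `q(0)` a nonunit, `π` would
divide `q(π)`, giving `ψ ϖ ∈ π ψ(ϖ) A` and so `ψ ϖ = 0`. -/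
theorem exists_pow_eq_mul_eval₂ [IsLocalRing W] [IsLocalRing A] {ϖ : W}
    (hϖ : maximalIdeal W = Ideal.span {ϖ}) (hπ : π ∈ maximalIdeal A)
    (hψ : ∀ a, ∃ w, π ∣ a - ψ w) {e N : ℕ} (he : 0 < e)
    (hspan : Ideal.span {ψ ϖ} = Ideal.span {π ^ e}) (hN : ψ ϖ ^ N = 0) (hne : ψ ϖ ≠ 0) :
    ∃ q : W[X], q.natDegree < e ∧ IsUnit (q.coeff 0) ∧ π ^ e = ψ ϖ * q.eval₂ ψ π := by
  have h1 : ψ ϖ ∣ π ^ e := by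
    rw [← Ideal.mem_span_singleton, hspan]; exact Ideal.mem_span_singleton_self _
  obtain ⟨d, hd⟩ : π ^ e ∣ ψ ϖ := by
    rw [← Ideal.mem_span_singleton, ← hspan]; exact Ideal.mem_span_singleton_self _
  obtain ⟨v, hv⟩ := h1
  obtain ⟨q, hq, rfl⟩ := exists_eq_eval₂_of_pow_dvd hψ ⟨v, hv⟩ hN v
  refine ⟨q, ?_, ?_, hv⟩
  · by_cases h0 : q = 0
    · simpa [h0] using he
    · exact (natDegree_lt_iff_degree_lt h0).mpr hq
  · by_contra h0
    have h0 : q.coeff 0 ∈ maximalIdeal W := h0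
    rw [hϖ, Ideal.mem_span_singleton] at h0
    obtain ⟨c, hc⟩ := h0
    have h2 : π ∣ q.eval₂ ψ π := by
      rw [← X_mul_divX_add q, eval₂_add, eval₂_mul, eval₂_X, eval₂_C, hc, map_mul, hd]
      exact dvd_add (dvd_mul_right _ _) (((dvd_pow_self π he.ne').mul_right d).mul_right _)
    obtain ⟨b, hb⟩ := h2
    have hu : IsUnit (1 - π * (b * d)) := by
      by_contra hu
      have hu : 1 - π * (b * d) ∈ maximalIdeal A := hu
      have := add_mem hu (Ideal.mul_mem_right (b * d) _ hπ)
      rw [sub_add_cancel] at this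
      exact (Ideal.ne_top_iff_one _).mp (maximalIdeal.isMaximal A).ne_top this
    refine hne ((hu.mul_left_eq_zero (a := ψ ϖ)).mp ?_)
    rw [hb] at hv
    linear_combination hd + d * hv

end Presentation

/-! ### Comparison of lifts of a residue ring. -/

section ResidueRings

open IsLocalRing Polynomial

/-- If `p = 0` in `A`, the image of `ZMod p` is a finite subfield. -/
theorem ResidueRings.HasNoFiniteSubfield.natCast_ne_zero {A : Type*} [CommRing A] [Nontrivial A]
    (h : HasNoFiniteSubfield A) {p : ℕ} (hp : p.Prime) : (p : A) ≠ 0 := by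
  intro h0
  have : Fact p.Prime := ⟨hp⟩
  have : CharP A p := by
    obtain ⟨q, hq⟩ := CharP.exists A
    have hdvd : q ∣ p := (CharP.cast_eq_zero_iff A q p).mp h0
    rcases (Nat.dvd_prime hp).mp hdvd with rfl | rfl
    · exact absurd (CharP.CharOne.subsingleton (R := A)) (not_subsingleton A)
    · exact hq
  let ι : ZMod p →+* A := ZMod.castHom dvd_rfl A
  refine h ⟨ι.range, ?_, Set.finite_range ι⟩
  exact (RingEquiv.ofBijective ι.rangeRestrict
    ⟨fun x y hxy ↦ ι.injective (congrArg Subtype.val hxy), ι.rangeRestrict_surjective⟩).symm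
      |>.toMulEquiv.isField (Field.toIsField (ZMod p))

theorem ResidueRings.span_natCast_eq_pow_nu {A : Type*} [CommRing A] [IsLocalRing A] {π : A}
    (hπ : maximalIdeal A = Ideal.span {π}) {n : ℕ} (hn : maximalIdeal A ^ n = ⊥) (a : ℕ) :
    Ideal.span {(a : A)} = maximalIdeal A ^ nu A a :=
  Nat.sInf_mem (s := {k | Ideal.span {(a : A)} = maximalIdeal A ^ k})
    (exists_span_singleton_eq_pow hπ hn a)

/-- Lifting the presentation of `A` by an Eisenstein polynomial to a complete discrete valuation
ring of characteristic zero that has `A` as a residue ring. -/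
theorem bijective_lift_of_residueRing
    {p : ℕ} [Fact p.Prime] {A : Type*} [CommRing A] [IsLocalRing A]
    [CharP (ResidueField A) p] [PerfectRing (ResidueField A) p] {n e r : ℕ} {π : A}
    (hπ : maximalIdeal A = Ideal.span {π}) (hn : maximalIdeal A ^ n = ⊥) (h1n : 1 < n)
    (hpe : Ideal.span {(p : A)} = maximalIdeal A ^ e)
    (her : Ideal.span {(e : A)} = maximalIdeal A ^ r) (hrn : r < n) (hern : e + 2 * r < n)
    {ψ : WittVector p (ResidueField A) →+* A} (hψ : ∀ x, residue A (ψ x) = x.coeff 0)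
    {q : (WittVector p (ResidueField A))[X]} (hqe : q.natDegree < e)
    {f : (WittVector p (ResidueField A))[X]} (hf : f = X ^ e - C (p : WittVector p _) * q)
    (hroot : f.eval₂ ψ π = 0) [IsDomain (AdjoinRoot f)] [IsDiscreteValuationRing (AdjoinRoot f)]
    (hmax : maximalIdeal (AdjoinRoot f) = Ideal.span {AdjoinRoot.root f})
    [IsAdicComplete (maximalIdeal (AdjoinRoot f)) (AdjoinRoot f)]
    {S : Type*} [CommRing S] [IsDomain S] [IsDiscreteValuationRing S]
    [hS : IsAdicComplete (maximalIdeal S) S] (θ : S →+* A) (hθ : Function.Surjective θ)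
    (hker : RingHom.ker θ = maximalIdeal S ^ n) :
    ∃ h : AdjoinRoot f →+* S, Function.Bijective h := by
  let ρ : S →+* ResidueField A := (residue A).comp θ
  have hρ : Function.Surjective ρ := residue_surjective.comp hθ
  have hρker : RingHom.ker ρ = maximalIdeal S :=
    eq_maximalIdeal (RingHom.ker_isMaximal_of_surjective ρ hρ)
  have hmem : ∀ {s}, ρ s = 0 ↔ s ∈ maximalIdeal S := fun {s} ↦ by
    rw [← hρker, RingHom.mem_ker]
  have : IsAdicComplete (RingHom.ker ρ) S := by rwa [hρker]
  obtain ⟨ψS, hψS⟩ := WittVector.exists_lift (p := p) (I := RingHom.ker ρ)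
    (by rw [RingHom.mem_ker, map_natCast, CharP.cast_eq_zero])
    ((RingHom.quotientKerEquivOfSurjective hρ).symm : ResidueField A →+* S ⧸ RingHom.ker ρ)
  have hψS : ∀ x, ρ (ψS x) = x.coeff 0 := by
    intro x
    have := congrArg (RingHom.quotientKerEquivOfSurjective hρ) (hψS x)
    rwa [RingHom.coe_coe, RingEquiv.apply_symm_apply] at this
  -- Both maps induce the identity on `k`, and the maximal ideal of `A` is nilpotent. This is what
  -- makes `y` below a root of `f` modulo `𝔪 ^ n`.
  have hcomp : θ.comp ψS = ψ := by
    refine WittVector.ringHom_ext_of_nilpotent hn ?_ _ _ fun x ↦ ?_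
    · rw [← residue_eq_zero_iff, map_natCast, CharP.cast_eq_zero]
    · rw [← residue_eq_zero_iff, map_sub, hψ, RingHom.comp_apply, sub_eq_zero]
      exact hψS x
  obtain ⟨y, hy⟩ := hθ π
  have hyirr : Irreducible y := by
    rw [IsDiscreteValuationRing.irreducible_iff_uniformizer, ← pow_one (maximalIdeal S)]
    exact (span_singleton_eq_pow_of_surjective hθ hker h1n (by rw [hy, pow_one, hπ])).symm
  have hvp : IsDiscreteValuationRing.addVal S (p : S) = e :=
    IsDiscreteValuationRing.addVal_eq_of_span_eq
      (span_singleton_eq_pow_of_surjective hθ hker (by omega) (by rwa [map_natCast]))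
  have hve : IsDiscreteValuationRing.addVal S (e : S) = r :=
    IsDiscreteValuationRing.addVal_eq_of_span_eq
      (span_singleton_eq_pow_of_surjective hθ hker hrn (by rwa [map_natCast]))
  have hfy : f.eval₂ ψS y ∈ maximalIdeal S ^ n := by
    rw [← hker, RingHom.mem_ker, hom_eval₂, hcomp, hy, hroot]
  obtain ⟨z, hz, hyz⟩ := IsDiscreteValuationRing.exists_unit_eval₂_mul_eq_zero ψS
    (WittVector.irreducible p) hyirr hqe (by rwa [map_natCast]) hve (hf ▸ hfy) hern
  rw [← hf] at hyz
  refine ⟨AdjoinRoot.lift ψS (y * z) hyz,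
    IsDiscreteValuationRing.bijective_of_map_maximalIdeal _ ?_ fun s ↦ ?_⟩
  · rw [hmax, Ideal.map_span, Set.image_singleton, AdjoinRoot.lift_root,
      Ideal.span_singleton_mul_right_unit hz, hyirr.maximalIdeal_eq]
  · obtain ⟨w, hw⟩ := WittVector.constantCoeff_surjective p (ρ s)
    refine ⟨AdjoinRoot.of f w, ?_⟩
    rw [AdjoinRoot.lift_of, ← hmem, map_sub, hψS, ← hw, sub_eq_zero]
    rfl

end ResidueRings

/-! ### Existence and uniqueness of the discrete valuation ring. -/

theorem theorem2p13
    (A : Type u) [CommRing A] [IsLocalRing A] [IsArtinianRing A] [IsPrincipalIdealRing A]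
    (p : ℕ) (hp : p.Prime)
    [PerfectField (IsLocalRing.ResidueField A)] [CharP (IsLocalRing.ResidueField A) p]
    (n : ℕ) (hlen : ResidueRings.HasLength A n)
    (hfin : ResidueRings.HasNoFiniteSubfield A)
    (hn : ResidueRings.nu A p + ResidueRings.nu A p * ResidueRings.nu A (ResidueRings.nu A p) < n) :
    ∃ (R : Type u) (_ : CommRing R) (_ : IsDomain R) (_ : IsDiscreteValuationRing R),
      IsAdicComplete (IsLocalRing.maximalIdeal R) R ∧ CharZero R ∧
      Nonempty (ResidueRings.ResidueRing R n ≃+* A) ∧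
      ∀ (S : Type v) [CommRing S] [IsDomain S] [IsDiscreteValuationRing S],
        IsAdicComplete (IsLocalRing.maximalIdeal S) S → CharZero S →
        Nonempty (ResidueRings.ResidueRing S n ≃+* A) → Nonempty (R ≃+* S) := by
  open IsLocalRing Polynomial in
  have : Fact p.Prime := ⟨hp⟩
  have : PerfectRing (ResidueField A) p := PerfectField.toPerfectRing p
  obtain ⟨π, hπ⟩ : ∃ π : A, maximalIdeal A = Ideal.span {π} :=
    (IsPrincipalIdealRing.principal (maximalIdeal A)).principal
  obtain ⟨hbot, hbot'⟩ := hlen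
  have hp0 : (p : A) ≠ 0 := hfin.natCast_ne_zero hp
  have hpm : (p : A) ∈ maximalIdeal A := by
    rw [← residue_eq_zero_iff, map_natCast, CharP.cast_eq_zero]
  have hpe := ResidueRings.span_natCast_eq_pow_nu hπ hbot p
  have her := ResidueRings.span_natCast_eq_pow_nu hπ hbot (ResidueRings.nu A p)
  generalize ResidueRings.nu A p = e at *
  generalize ResidueRings.nu A e = r at *
  have he : 0 < e := by
    rw [Nat.pos_iff_ne_zero]
    rintro rfl
    rw [pow_zero, Ideal.one_eq_top, Ideal.span_singleton_eq_top] at hpe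
    exact hpm hpe
  have hrn : r < n := lt_of_le_of_lt (Nat.le_mul_of_pos_left r he) (by omega)
  -- The bound needed by Hensel's lemma: `2 r ≤ e r` if `e ≥ 2`, while `e = 1` is a unit and gives
  -- `r = 0`.
  have hern : e + 2 * r < n := by
    rcases Nat.lt_or_ge e 2 with h | h
    · obtain rfl : e = 1 := by omega
      have : r = 0 := by
        by_contra hr
        rw [Nat.cast_one, Ideal.span_singleton_one] at her
        exact (maximalIdeal.isMaximal A).ne_top (top_le_iff.mp (her.le.trans (Ideal.pow_le_self hr)))
      omega
    · have := Nat.mul_le_mul_right r h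
      omega
  have : IsAdicComplete (maximalIdeal A) A := IsAdicComplete.of_pow_eq_bot hbot
  obtain ⟨ψ, hψ⟩ := WittVector.exists_lift (p := p) hpm (RingHom.id (ResidueField A))
  have hψ : ∀ x, residue A (ψ x) = x.coeff 0 := hψ
  have hψs : ∀ a, ∃ w, π ∣ a - ψ w := by
    intro a
    obtain ⟨w, hw⟩ := WittVector.constantCoeff_surjective p (residue A a)
    refine ⟨w, ?_⟩
    rw [← Ideal.mem_span_singleton, ← hπ, ← residue_eq_zero_iff, map_sub, hψ, ← hw, sub_eq_zero]
    rfl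
  have hϖ : Irreducible (p : WittVector p (ResidueField A)) := WittVector.irreducible p
  have : IsAdicComplete (maximalIdeal (WittVector p (ResidueField A)))
      (WittVector p (ResidueField A)) := by
    rw [hϖ.maximalIdeal_eq]; infer_instance
  have hpN : (p : A) ^ n = 0 := by
    rw [← Ideal.mem_bot, ← hbot]; exact Ideal.pow_mem_pow hpm n
  have hspan : Ideal.span {(p : A)} = Ideal.span {π ^ e} := by
    rw [hpe, hπ, Ideal.span_singleton_pow]
  obtain ⟨q, hqe, hq0, hq⟩ := exists_pow_eq_mul_eval₂ (ϖ := (p : WittVector p (ResidueField A)))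
    hϖ.maximalIdeal_eq (hπ ▸ Ideal.mem_span_singleton_self π) hψs he (by rwa [map_natCast])
    (by rwa [map_natCast]) (by rwa [map_natCast])
  obtain ⟨f, hf⟩ : ∃ f, f = X ^ e - C (p : WittVector p (ResidueField A)) * q := ⟨_, rfl⟩
  have hroot : f.eval₂ ψ π = 0 := by
    rw [hf, eval₂_sub, eval₂_mul, eval₂_C, eval₂_pow, eval₂_X, hq, sub_self]
  obtain ⟨hmon, hdeg⟩ := monic_and_natDegree_X_pow_sub_C_mul hqe (p : WittVector p (ResidueField A))
  have heis := isEisensteinAt_X_pow_sub_C_mul hqe hϖ hq0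
  rw [← hf] at hmon hdeg heis
  obtain ⟨_, _, hmax, hcomplete⟩ := heis.isDiscreteValuationRing hmon (by omega)
  have hθ : Function.Surjective (AdjoinRoot.lift ψ π hroot) := by
    intro a
    obtain ⟨g, -, rfl⟩ := exists_eq_eval₂_of_pow_dvd hψs
      (ϖ := (p : WittVector p (ResidueField A))) ⟨_, hq⟩ (by rwa [map_natCast]) a
    exact ⟨AdjoinRoot.mk f g, AdjoinRoot.lift_mk _ _⟩
  have hker := IsDiscreteValuationRing.ker_eq_pow hθ hbot hbot'
  refine ⟨AdjoinRoot f, inferInstance, inferInstance, inferInstance, hcomplete, ?_, ?_, ?_⟩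
  · refine charZero_of_prime_mem hp ?_ fun h ↦ hp0 ?_
    · rw [hmax, ← map_natCast (AdjoinRoot.of f)]
      exact heis.of_mem_span_root (by omega) hϖ
    · rw [← map_natCast (AdjoinRoot.lift ψ π hroot), h, map_zero]
  · exact ⟨(Ideal.quotEquivOfEq hker.symm).trans (RingHom.quotientKerEquivOfSurjective hθ)⟩
  · intro S _ _ _ hS _ ⟨ε⟩
    obtain ⟨h, hh⟩ := bijective_lift_of_residueRing hπ hbot (by omega) hpe her hrn hern hψ hqe hf
      hroot hmax ((ε : ResidueRings.ResidueRing S n →+* A).comp (Ideal.Quotient.mk _))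
      (ε.surjective.comp Ideal.Quotient.mk_surjective) (by
        ext x
        simp [RingHom.mem_ker, Ideal.Quotient.eq_zero_iff_mem])
    exact ⟨RingEquiv.ofBijective h hh⟩
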